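/- For positive integer $n$ and real numbers $m_j>0$, $k_j>0$, $b_j\ge 0$ ($j=1,\dots,n$), let $\boldsymbol M=\mathrm{diag}(m_1,\dots,m_n)$, let $\boldsymbol K$ be the symmetric tridiagonal $n\times n$ matrix with diagonal entries $k_1+k_2,\,k_2+k_3,\,\dots,\,k_{n-1}+k_n,\,k_n$ and with the entries in positions $(j-1,j)$ and $(j,j-1)$ equal to $-k_j$ for $j=2,\dots,n$, and let $\boldsymbol B$ be the matrix of the same form with each $k_j$ replaced by $b_j$. Let $M_1,\dots,M_m>0$ and $0<\lambda_1<\lambda_2<\cdots<\lambda_m$ be real numbers, and let $t_1,\dots,t_m\ge 1$ be integers with $\sum_{i=1}^m t_i=n$. If $t_i\le i$ for every $i=1,\dots,m$, then there exist real numbers $m_j>0$, $k_j>0$, $b_j\ge 0$, $j=1,\dots,n$, and $m$ distinct indices $i_1,\dots,i_m\in\{1,\dots,n\}$ such that $m_{i_l}=M_l$ for $l=1,\dots,m$ and $$\prod_{i=1}^m(\lambda-\lambda_i)^{t_i}\ \Big|\ \det\bigl(\boldsymbol K-\lambda(\boldsymbol M+\boldsymbol B)\bigr)$$ as polynomials in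 $\lambda$. -/

import Mathlib

open Polynomial

/-- The `n × n` tridiagonal matrix of a fixed-free chain with link coefficients `c₁, …, cₙ`
(here indexed from `0`): diagonal `c₁ + c₂, …, cₙ₋₁ + cₙ, cₙ`, and both entries coupling
positions `j - 1` and `j` equal to `-cⱼ`. It gives the stiffness matrix `K` from the spring
stiffnesses `kⱼ`, and the matrix `B` from the inertances `bⱼ`. -/
noncomputable def chainMatrix {n : ℕ} (c : Fin n → ℝ) : Matrix (Fin n) (Fin n) ℝ :=
  Matrix.of fun i j =>
    if i = j then c i + (if h : (i : ℕ) + 1 < n then c ⟨(i : ℕ) + 1, h⟩ else 0)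
    else if (i : ℕ) + 1 = (j : ℕ) then -c j
    else if (j : ℕ) + 1 = (i : ℕ) then -c i
    else 0

/-- The polynomial `det (K - λ (M + B))` in the variable `λ = X`, where `M` is the diagonal
matrix of the masses, and `K`, `B` are the stiffness and inertance matrices of the
fixed-free mass-spring-inerter chain. -/
noncomputable def pencilDet {n : ℕ} (mass k b : Fin n → ℝ) : ℝ[X] :=
  ((chainMatrix k).map (C : ℝ → ℝ[X])
    - (X : ℝ[X]) • (Matrix.diagonal mass + chainMatrix b).map (C : ℝ → ℝ[X])).det

open Filter Topology

/-! The chain is built from the free end towards the fixed end. Let `w = N / P` be the apparent mass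
of the part already built. Prepending a mass `μ` and a link with `c = k - λ b` turns it into `w'`
with `1 / w' = 1 / (w + μ) - λ / c`, and the new `P` is the characteristic polynomial.

Multiplicity comes from a hit: if `w (λᵢ) = -μ` and `c (λᵢ) = 0`, both new polynomials acquire a
factor `X - λᵢ`. As `w` is nondecreasing away from its poles, the cofactor of the new `P` does not
vanish at `λᵢ`, so further hits remain possible. The last factor at each `λᵢ` comes from making `1 /
w` vanish there at the end.

The work is split into phases `j = 0, …, m - 1`. Phase `j` contains one creation, which makes `1 /
w` adjustable at `λⱼ`, and hits at some indices `i > j`. Counted from `0`, index `i` has `i` earlier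
phases, and `t i ≤ i + 1` lets it be hit in the last `t i - 1` of them. This uses `∑ t i = n`
elements. Each phase inserts the mass `M j` exactly, in its creation or in its first hit
(`create_stiff`, `create_before_hit`, `RealizableFamily.hit`).

Later insertions disturb the values of `1 / w` at the indices already created. So a whole family is
carried along: those values `v` range over a neighbourhood of `0`, and the values of `w` at the
other indices are `C¹` functions of `v`. With links of stiffness of order `1 / ε` the disturbance
has order `ε`, and the implicit function theorem (`RealizableFamily.perturb`) finds the earlier `v`
that yields the desired new one. -/

/-- The dynamic stiffness polynomials of a chain, given as the list of its triples
`(mass, stiffness, inertance)` from the fixed end to the free end. The first component is the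
characteristic polynomial, and `-X` times the quotient of the second by the first is the dynamic
stiffness seen from the fixed end. -/
noncomputable def chainPoly : List (ℝ × ℝ × ℝ) → ℝ[X] × ℝ[X]
  | [] => (1, 0)
  | x :: L =>
    ((C x.2.1 - X * C x.2.2) * (chainPoly L).1 - X * ((chainPoly L).2 + C x.1 * (chainPoly L).1),
      (C x.2.1 - X * C x.2.2) * ((chainPoly L).2 + C x.1 * (chainPoly L).1))

/-! ### The determinant of the pencil through a three-term recurrence -/

theorem det_of_first_row_col {R : Type*} [CommRing R] {n : ℕ}
    (A : Matrix (Fin (n + 2)) (Fin (n + 2)) R)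
    (hr : ∀ j : Fin n, A 0 j.succ.succ = 0) (hc : ∀ i : Fin n, A i.succ.succ 0 = 0) :
    A.det = A 0 0 * (A.submatrix Fin.succ Fin.succ).det
      - A 0 1 * A 1 0 * (A.submatrix (fun i : Fin n => i.succ.succ)
          (fun i : Fin n => i.succ.succ)).det := by
  rw [Matrix.det_succ_row_zero, Fin.sum_univ_succ, Fin.sum_univ_succ,
    Finset.sum_eq_zero (fun j _ => by rw [hr]; simp)]
  have h : (A.submatrix Fin.succ (Fin.succ (0 : Fin (n + 1))).succAbove).det
      = A 1 0 * (A.submatrix (fun i : Fin n => i.succ.succ)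
          (fun i : Fin n => i.succ.succ)).det := by
    rw [Matrix.det_succ_column_zero, Fin.sum_univ_succ, Finset.sum_eq_zero]
    · simp only [Matrix.submatrix_submatrix, Matrix.submatrix_apply]
      simp
      congr 2
    · intro i _
      have : A i.succ.succ 0 = 0 := hc i
      simp [this]
  rw [h]
  simp
  ring

/-- The matrix `K - λ (M + B)`. -/
noncomputable def pencilMatrix {n : ℕ} (mass k b : Fin n → ℝ) : Matrix (Fin n) (Fin n) ℝ[X] :=
  (chainMatrix k).map (C : ℝ → ℝ[X])
    - (X : ℝ[X]) • (Matrix.diagonal mass + chainMatrix b).map (C : ℝ → ℝ[X])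

theorem pencilMatrix_submatrix_succ {n : ℕ} (mass k b : Fin (n + 1) → ℝ) :
    (pencilMatrix mass k b).submatrix Fin.succ Fin.succ =
      pencilMatrix (Fin.tail mass) (Fin.tail k) (Fin.tail b) := by
  ext1 i j
  simp [pencilMatrix, chainMatrix, Matrix.diagonal_apply, Fin.tail]

theorem pencilDet_succ_succ {n : ℕ} (mass k b : Fin (n + 2) → ℝ) :
    pencilDet mass k b =
      ((C (k 0) - X * C (b 0)) + (C (k 1) - X * C (b 1)) - X * C (mass 0)) *
        pencilDet (Fin.tail mass) (Fin.tail k) (Fin.tail b)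
      - (C (k 1) - X * C (b 1)) ^ 2 *
        pencilDet (Fin.tail (Fin.tail mass)) (Fin.tail (Fin.tail k)) (Fin.tail (Fin.tail b)) := by
  have h : pencilDet mass k b = (pencilMatrix mass k b).det := rfl
  have h1 : pencilDet (Fin.tail mass) (Fin.tail k) (Fin.tail b) =
      ((pencilMatrix mass k b).submatrix Fin.succ Fin.succ).det := by
    rw [pencilMatrix_submatrix_succ]; rfl
  have h2 : pencilDet (Fin.tail (Fin.tail mass)) (Fin.tail (Fin.tail k)) (Fin.tail (Fin.tail b)) =
      ((pencilMatrix mass k b).submatrix (fun i : Fin n => i.succ.succ)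
        (fun i : Fin n => i.succ.succ)).det := by
    have h3 : (pencilMatrix mass k b).submatrix (fun i : Fin n => i.succ.succ)
        (fun i : Fin n => i.succ.succ) =
        ((pencilMatrix mass k b).submatrix Fin.succ Fin.succ).submatrix Fin.succ Fin.succ := rfl
    rw [h3, pencilMatrix_submatrix_succ, pencilMatrix_submatrix_succ]; rfl
  have e00 : pencilMatrix mass k b 0 0 =
      (C (k 0) - X * C (b 0)) + (C (k 1) - X * C (b 1)) - X * C (mass 0) := by
    simp [pencilMatrix, chainMatrix]
    ring
  have e01 : pencilMatrix mass k b 0 1 = -(C (k 1) - X * C (b 1)) := by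
    simp [pencilMatrix, chainMatrix]
    ring
  have e10 : pencilMatrix mass k b 1 0 = -(C (k 1) - X * C (b 1)) := by
    simp [pencilMatrix, chainMatrix]
    ring
  rw [h, h1, h2, det_of_first_row_col, e00, e01, e10]
  · ring
  · intro j
    simp [pencilMatrix, chainMatrix, Fin.ext_iff]
  · intro j
    simp [pencilMatrix, chainMatrix, Fin.ext_iff]

theorem pencilDet_eq_chainPoly (L : List (ℝ × ℝ × ℝ)) :
    pencilDet (fun i : Fin L.length => (L.get i).1) (fun i => (L.get i).2.1)
      (fun i => (L.get i).2.2) = (chainPoly L).1 := by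
  match L with
  | [] => simp [pencilDet, chainPoly]
  | [x] =>
    simp [pencilDet, chainPoly, chainMatrix]
    ring
  | x :: y :: L =>
    have h1 := pencilDet_eq_chainPoly (y :: L)
    have h2 := pencilDet_eq_chainPoly L
    have h := pencilDet_succ_succ (n := L.length) (fun i => ((x :: y :: L).get i).1)
      (fun i => ((x :: y :: L).get i).2.1) (fun i => ((x :: y :: L).get i).2.2)
    refine h.trans ?_
    refine Eq.trans (congrArg₂ (fun p q => _ * p - _ * q) h1 h2) ?_
    simp [chainPoly]
    ring

/-! ### Exact effect of inserting one element -/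

/-- There is a chain with positive parameters whose masses contain the list `Ms`, whose polynomials
`P`, `N` are `D * p`, `D * ν` with `D = ∏ i, (X - lam i) ^ s i` and `ν / p` increasing, such that
`p / ν` has the values `v l` at `lam l` for `l < J` and `ν / p` has the values `w i` at `lam i` for
`J ≤ i`. -/
def Realizable {m : ℕ} (lam : Fin m → ℝ) (s : Fin m → ℕ) (Ms : List ℝ) (J : ℕ)
    (v w : Fin m → ℝ) : Prop :=
  ∃ (L : List (ℝ × ℝ × ℝ)) (p ν : ℝ[X]),
    (∀ x ∈ L, 0 < x.1 ∧ 0 < x.2.1 ∧ 0 ≤ x.2.2) ∧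
    L.length = J + ∑ i, s i ∧
    Ms.Sublist (L.map Prod.fst) ∧
    (chainPoly L).1 = (∏ i, (X - C (lam i)) ^ s i) * p ∧
    (chainPoly L).2 = (∏ i, (X - C (lam i)) ^ s i) * ν ∧
    (∀ x, 0 ≤ ν.derivative.eval x * p.eval x - ν.eval x * p.derivative.eval x) ∧
    (∀ l : Fin m, (l : ℕ) < J → ν.eval (lam l) ≠ 0 ∧ p.eval (lam l) = v l * ν.eval (lam l)) ∧
    (∀ i : Fin m, J ≤ i → p.eval (lam i) ≠ 0 ∧ ν.eval (lam i) = w i * p.eval (lam i))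

namespace Realizable

variable {m : ℕ} {lam : Fin m → ℝ} {s : Fin m → ℕ} {Ms Ms' : List ℝ} {v w v' w' : Fin m → ℝ}

theorem nil (v : Fin m → ℝ) : Realizable lam 0 [] 0 v 0 :=
  ⟨[], 1, 0, by simp [chainPoly]⟩

theorem sublist_cons_of_eq_or {α : Type*} {A A' B : List α} {a : α} (h : A.Sublist B)
    (hA : A' = A ∨ A' = a :: A) : A'.Sublist (a :: B) := by
  rcases hA with rfl | rfl
  · exact h.cons a
  · exact h.cons_cons a

/-- The map `1 / w' = 1 / (w + μ) - λ / c`, written with `v = 1 / w` at indices up to `j` and with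
`w` above. Index `j` passes from the second kind to the first. -/
theorem create {j : Fin m} (h : Realizable lam s Ms j v w) {μ k b : ℝ} (hμ : 0 < μ) (hk : 0 < k)
    (hb : 0 ≤ b) (hMs : Ms' = Ms ∨ Ms' = μ :: Ms)
    (hlt : ∀ l < j, k - lam l * b ≠ 0 ∧ 1 + μ * v l ≠ 0 ∧
      v' l = v l / (1 + μ * v l) - lam l / (k - lam l * b))
    (hj : k - lam j * b ≠ 0 ∧ w j + μ ≠ 0 ∧ v' j = 1 / (w j + μ) - lam j / (k - lam j * b))
    (hgt : ∀ i, j < i → k - lam i * b - lam i * (w i + μ) ≠ 0 ∧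
      w' i = (k - lam i * b) * (w i + μ) / (k - lam i * b - lam i * (w i + μ))) :
    Realizable lam s Ms' (j + 1) v' w' := by
  obtain ⟨L, p, ν, hL, hlen, hsub, hP, hN, hW, hv, hw⟩ := h
  refine ⟨(μ, k, b) :: L, (C k - X * C b) * p - X * (ν + C μ * p),
    (C k - X * C b) * (ν + C μ * p), ?_, ?_, ?_, ?_, ?_, ?_, ?_, ?_⟩
  · simpa using ⟨⟨hμ, hk, hb⟩, fun a b c h => hL (a, b, c) h⟩
  · simp [hlen]; ring
  · exact sublist_cons_of_eq_or hsub hMs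
  · simp only [chainPoly, hP, hN]; ring
  · simp only [chainPoly, hP, hN]; ring
  · intro x
    -- The new Wronskian is `(k - x b)²` times the old one plus `k (ν + μ p)²`.
    have h0 := mul_nonneg (sq_nonneg (k - x * b)) (hW x)
    have h1 := mul_nonneg hk.le (sq_nonneg (ν.eval x + μ * p.eval x))
    simp
    linarith
  · intro l hl
    rcases (Nat.lt_succ_iff_lt_or_eq.1 hl) with hl | hl
    · obtain ⟨h1, h2⟩ := hv l hl
      obtain ⟨h3, h4, h5⟩ := hlt l hl
      have h6 : ν.eval (lam l) + μ * p.eval (lam l) = (1 + μ * v l) * ν.eval (lam l) := by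
        rw [h2]; ring
      simp only [eval_mul, eval_sub, eval_add, eval_C, eval_X, h6]
      refine ⟨mul_ne_zero h3 (mul_ne_zero h4 h1), ?_⟩
      rw [h5, h2]
      generalize 1 + μ * v l = d at h4 ⊢
      field_simp
    · obtain rfl : l = j := Fin.ext hl
      obtain ⟨h1, h2⟩ := hw l le_rfl
      obtain ⟨h3, h4, h5⟩ := hj
      have h6 : ν.eval (lam l) + μ * p.eval (lam l) = (w l + μ) * p.eval (lam l) := by
        rw [h2]; ring
      simp only [eval_mul, eval_sub, eval_add, eval_C, eval_X, h6]
      refine ⟨mul_ne_zero h3 (mul_ne_zero h4 h1), ?_⟩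
      rw [h5]
      generalize k - lam l * b = c at h3 ⊢
      generalize w l + μ = d at h4 ⊢
      field_simp
  · intro i hi
    obtain ⟨h1, h2⟩ := hw i (Nat.le_of_succ_le hi)
    obtain ⟨h3, h5⟩ := hgt i hi
    have h6 : ν.eval (lam i) + μ * p.eval (lam i) = (w i + μ) * p.eval (lam i) := by
      rw [h2]; ring
    simp only [eval_mul, eval_sub, eval_add, eval_C, eval_X, h6]
    have h7 : (k - lam i * b) * p.eval (lam i) - lam i * ((w i + μ) * p.eval (lam i)) =
      (k - lam i * b - lam i * (w i + μ)) * p.eval (lam i) := by ring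
    rw [h7]
    refine ⟨mul_ne_zero h3 h1, ?_⟩
    rw [h5]
    generalize k - lam i * b - lam i * (w i + μ) = d at h3 ⊢
    field_simp

/-- The mass `-w i` makes `ν + μ p` divisible by `X - λᵢ`, and the link `B (λᵢ - X)` has the same
root, so this factor leaves both polynomials. -/
theorem hit {J : ℕ} (h : Realizable lam s Ms J v w) (hpos : ∀ i, 0 < lam i)
    (hinj : Function.Injective lam) {i : Fin m} (hi : J ≤ i) (hwi : w i < 0) {B : ℝ} (hB : 0 < B)
    (hMs : Ms' = Ms ∨ Ms' = -w i :: Ms)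
    (hlt : ∀ l : Fin m, (l : ℕ) < J → 1 - w i * v l ≠ 0 ∧
      v' l = v l / (1 - w i * v l) - lam l / (B * (lam i - lam l)))
    (hge : ∀ l : Fin m, J ≤ l → l ≠ i → B * (lam i - lam l) - lam l * (w l - w i) ≠ 0 ∧
      w' l = B * (lam i - lam l) * (w l - w i) / (B * (lam i - lam l) - lam l * (w l - w i)))
    (hi' : w' i = 0) :
    Realizable lam (s + Pi.single i 1) Ms' J v' w' := by
  obtain ⟨L, p, ν, hL, hlen, hsub, hP, hN, hW, hv, hw⟩ := h
  obtain ⟨hp, hν⟩ := hw i hi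
  obtain ⟨g, hg⟩ : (X - C (lam i)) ∣ ν + C (-w i) * p := by
    rw [dvd_iff_isRoot]
    simp [hν]
  have hgx : ∀ x, ν.eval x - w i * p.eval x = (x - lam i) * g.eval x := fun x => by
    have := congrArg (eval x) hg
    simpa [sub_eq_add_neg] using this
  have hgd : ∀ x, ν.derivative.eval x - w i * p.derivative.eval x =
      g.eval x + (x - lam i) * g.derivative.eval x := fun x => by
    have := congrArg (fun q => eval x (derivative q)) hg
    simpa [sub_eq_add_neg] using this
  have hD : (∏ l, (X - C (lam l)) ^ ((s + Pi.single i 1 : Fin m → ℕ) l)) =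
      (∏ l, (X - C (lam l)) ^ s l) * (X - C (lam i)) := by
    simp only [Pi.add_apply, pow_add, Finset.prod_mul_distrib]
    congr 1
    rw [Finset.prod_eq_single i]
    · simp
    · intro b _ hb
      simp [hb]
    · simp
  refine ⟨(-w i, B * lam i, B) :: L, -(C B * p) - X * g, -(C B * (X - C (lam i)) * g),
    ?_, ?_, ?_, ?_, ?_, ?_, ?_, ?_⟩
  · simpa using ⟨⟨hwi, mul_pos hB (hpos i), hB.le⟩, fun a b c h => hL (a, b, c) h⟩
  · simp [hlen, Finset.sum_add_distrib]; ring
  · exact sublist_cons_of_eq_or hsub hMs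
  · rw [hD]
    simp only [chainPoly, hP, hN]
    rw [mul_left_comm (C (-w i)), ← mul_add, hg]
    simp only [C_mul]
    ring
  · rw [hD]
    simp only [chainPoly, hP, hN]
    rw [mul_left_comm (C (-w i)), ← mul_add, hg]
    simp only [C_mul]
    ring
  · intro x
    have h0 := mul_nonneg (sq_nonneg B) (hW x)
    have h1 := mul_nonneg (mul_pos hB (hpos i)).le (sq_nonneg (g.eval x))
    have h2 := hgx x
    have h3 := hgd x
    have h4 : ν.eval x = w i * p.eval x + (x - lam i) * g.eval x := by linarith
    have h5 : ν.derivative.eval x = w i * p.derivative.eval x + (g.eval x +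
      (x - lam i) * g.derivative.eval x) := by linarith
    rw [h4, h5] at h0
    simp
    linarith
  · intro l hl
    have hne : lam l - lam i ≠ 0 := sub_ne_zero.2 fun h => by
      have := hinj h; subst this; omega
    have hne' : lam i - lam l ≠ 0 := fun h => hne (by linarith)
    obtain ⟨h1, h2⟩ := hv l hl
    obtain ⟨h3, h4⟩ := hlt l hl
    have h5 : (lam l - lam i) * g.eval (lam l) = (1 - w i * v l) * ν.eval (lam l) := by
      rw [← hgx, h2]; ring
    have hB' := hB.ne'
    simp only [eval_mul, eval_sub, eval_neg, eval_C, eval_X]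
    have h6 : g.eval (lam l) = (1 - w i * v l) * ν.eval (lam l) / (lam l - lam i) := by
      rw [← h5]; field_simp
    have h7 : g.eval (lam l) ≠ 0 := by
      rw [h6]; exact div_ne_zero (mul_ne_zero h3 h1) hne
    refine ⟨neg_ne_zero.2 (mul_ne_zero (mul_ne_zero hB' hne) h7), ?_⟩
    have h8 : -(B * (lam l - lam i) * g.eval (lam l)) = -(B * ((1 - w i * v l) * ν.eval (lam l))) := by
      rw [mul_assoc, h5]
    rw [h8, h4, h6, h2]
    have h9 : lam l - lam i = -(lam i - lam l) := by ring
    rw [h9]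
    generalize 1 - w i * v l = d at h3 ⊢
    generalize lam i - lam l = x at hne' ⊢
    field_simp
    ring
  · intro l hl
    have hB' := hB.ne'
    simp only [eval_mul, eval_sub, eval_neg, eval_C, eval_X]
    by_cases hli : l = i
    · subst hli
      have h0 := hW (lam l)
      have h1 := hgx (lam l)
      have h2 := hgd (lam l)
      rw [sub_self, zero_mul] at h1 h2
      have h3 : ν.eval (lam l) = w l * p.eval (lam l) := by linarith
      have h4 : ν.derivative.eval (lam l) = w l * p.derivative.eval (lam l) + g.eval (lam l) := by
        linarith
      rw [h3, h4] at h0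
      have h5 : 0 ≤ g.eval (lam l) * p.eval (lam l) := by linarith
      refine ⟨fun h => ?_, by rw [hi']; ring⟩
      -- The Wronskian at `λᵢ` is `g p`, hence nonnegative; with `p ≠ 0` this keeps `-B p - λᵢ g`
      -- from vanishing.
      have h6 : B * (p.eval (lam l)) ^ 2 + lam l * (g.eval (lam l) * p.eval (lam l)) = 0 := by
        linear_combination -p.eval (lam l) * h
      have h7 := mul_pos hB (pow_pos (abs_pos.2 hp) 2)
      rw [sq_abs] at h7
      have h8 := mul_nonneg (hpos l).le h5
      linarith
    · have hne : lam l - lam i ≠ 0 := sub_ne_zero.2 fun h => hli (hinj h)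
      have hne' : lam i - lam l ≠ 0 := fun h => hne (by linarith)
      obtain ⟨h1, h2⟩ := hw l hl
      obtain ⟨h3, h4⟩ := hge l hl hli
      have h5 : (lam l - lam i) * g.eval (lam l) = (w l - w i) * p.eval (lam l) := by
        rw [← hgx, h2]; ring
      have h6 : g.eval (lam l) = -((w l - w i) * p.eval (lam l) / (lam i - lam l)) := by
        rw [← h5]; field_simp; ring
      have h7 : -(B * p.eval (lam l)) - lam l * g.eval (lam l) =
          -((B * (lam i - lam l) - lam l * (w l - w i)) * p.eval (lam l) / (lam i - lam l)) := by
        rw [h6]; field_simp; ring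
      rw [h7]
      refine ⟨neg_ne_zero.2 (div_ne_zero (mul_ne_zero h3 h1) hne'), ?_⟩
      rw [mul_assoc, h5, h4]
      generalize B * (lam i - lam l) - lam l * (w l - w i) = d at h3 ⊢
      generalize lam i - lam l = x at hne' ⊢
      generalize w l - w i = y
      field_simp

end Realizable

/-! ### Smooth families and the perturbation argument -/

theorem exists_contDiffAt_fixedPoint {E : Type*} [NormedAddCommGroup E] [NormedSpace ℝ E]
    [CompleteSpace E] {Φ : (ℝ × E) × E → E} {x₀ : E}
    (hΦ : ContDiffAt ℝ 1 Φ ((0, 0), x₀)) (h0 : ∀ x, Φ ((0, 0), x) = x₀) :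
    ∃ φ : ℝ × E → E, ContDiffAt ℝ 1 φ (0, 0) ∧ φ (0, 0) = x₀ ∧
      ∀ᶠ z in 𝓝 (0, 0), φ z = Φ (z, φ z) := by
  let F : (ℝ × E) × E → E := fun z => z.2 - Φ z
  have hF : ContDiffAt ℝ 1 F ((0, 0), x₀) := contDiffAt_snd.sub hΦ
  -- At parameter `(0, 0)` the map `F` is `x ↦ x - x₀`, so its partial derivative is invertible.
  have hFd : fderiv ℝ F ((0, 0), x₀) ∘L .inr ℝ (ℝ × E) E = ContinuousLinearMap.id ℝ E := by
    have h1 : HasFDerivAt F (fderiv ℝ F ((0, 0), x₀)) ((0, 0), x₀) :=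
      (hF.differentiableAt (by simp)).hasFDerivAt
    have h2 := h1.comp x₀ (hasFDerivAt_prodMk_right ((0 : ℝ), (0 : E)) x₀)
    have h3 : HasFDerivAt (F ∘ fun x => (((0 : ℝ), (0 : E)), x)) (ContinuousLinearMap.id ℝ E) x₀ := by
      have : (F ∘ fun x => (((0 : ℝ), (0 : E)), x)) = fun x => x - x₀ := by
        funext x
        simp [F, h0]
      rw [this]
      exact (hasFDerivAt_id x₀).sub_const x₀
    exact h2.unique h3
  have hinv : (fderiv ℝ F ((0, 0), x₀) ∘L .inr ℝ (ℝ × E) E).IsInvertible := by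
    rw [hFd]
    exact ContinuousLinearMap.isInvertible_equiv (f := ContinuousLinearEquiv.refl ℝ E)
  refine ⟨hF.implicitFunction one_ne_zero hinv, hF.contDiffAt_implicitFunction one_ne_zero hinv,
    hF.implicitFunction_apply_self one_ne_zero hinv, ?_⟩
  filter_upwards [hF.eventually_apply_implicitFunction one_ne_zero hinv] with z hz
  have : F ((0, 0), x₀) = 0 := by simp [F, h0]
  rw [this] at hz
  exact sub_eq_zero.1 hz

/-- Near `v = 0` there are realizations with data `v`, `w v` that depend smoothly on `v`. -/
def RealizableFamily {m : ℕ} (lam : Fin m → ℝ) (s : Fin m → ℕ) (Ms : List ℝ) (J : ℕ)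
    (w : (Fin m → ℝ) → Fin m → ℝ) : Prop :=
  ContDiffAt ℝ 1 w 0 ∧ ∀ᶠ v in 𝓝 0, Realizable lam s Ms J v (w v)

/-- A point `z = ((ε, y), x)` encodes old data `v = ε x`, new data `v' = ε y` and new values `r ε •
W z`. The factor `r` absorbs a possible blow-up as `ε → 0`, so that `W` stays smooth. The equation
`x = Φ z` says that the insertion carries `ε x` to `ε y`; open conditions on `W` at `ε = 0` persist.
-/
theorem RealizableFamily.perturb {m : ℕ} {lam : Fin m → ℝ} {s s' : Fin m → ℕ} {Ms Ms' : List ℝ}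
    {J J' : ℕ} {w : (Fin m → ℝ) → Fin m → ℝ} (h : RealizableFamily lam s Ms J w)
    {Φ W : (ℝ × (Fin m → ℝ)) × (Fin m → ℝ) → Fin m → ℝ} {x₀ : Fin m → ℝ} (r : ℝ → ℝ)
    (hΦ : ContDiffAt ℝ 1 Φ ((0, 0), x₀)) (hΦ0 : ∀ x, Φ ((0, 0), x) = x₀)
    (hW : ContDiffAt ℝ 1 W ((0, 0), x₀))
    (hstep : ∀ᶠ z : (ℝ × (Fin m → ℝ)) × (Fin m → ℝ) in 𝓝 ((0, 0), x₀), 0 < z.1.1 → z.2 = Φ z →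
      Realizable lam s Ms J (z.1.1 • z.2) (w (z.1.1 • z.2)) →
      Realizable lam s' Ms' J' (z.1.1 • z.1.2) (r z.1.1 • W z))
    {Q : (Fin m → ℝ) → Prop} (hQ : ∀ᶠ z in 𝓝 (W ((0, 0), x₀)), Q z) :
    ∃ ε > 0, ∃ φ : (Fin m → ℝ) → Fin m → ℝ,
      RealizableFamily lam s' Ms' J' (fun v => r ε • W ((ε, ε⁻¹ • v), φ v)) ∧
      Q (W ((ε, 0), φ 0)) := by
  obtain ⟨φ, hφ, hφ0, hφe⟩ := exists_contDiffAt_fixedPoint hΦ hΦ0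
  have hpt : Tendsto (fun z : ℝ × (Fin m → ℝ) => (z, φ z)) (𝓝 (0, 0)) (𝓝 ((0, 0), x₀)) := by
    have := (continuousAt_id.prodMk hφ.continuousAt).tendsto
    simpa [hφ0] using this
  have hv : Tendsto (fun z : ℝ × (Fin m → ℝ) => z.1 • φ z) (𝓝 (0, 0)) (𝓝 0) := by
    have : ContinuousAt (fun z : ℝ × (Fin m → ℝ) => z.1 • φ z) (0, 0) :=
      continuousAt_fst.smul hφ.continuousAt
    have h1 := this.tendsto
    rwa [zero_smul] at h1
  have e1 := hpt.eventually hstep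
  have e2 := hv.eventually h.2
  have hW' : ContDiffAt ℝ 1 (fun z => W (z, φ z)) (0, 0) := by
    have : ContDiffAt ℝ 1 W ((fun z : ℝ × (Fin m → ℝ) => (z, φ z)) (0, 0)) := by
      simpa only [hφ0] using hW
    exact this.comp (0, 0) (contDiffAt_id.prodMk hφ)
  have e3 := hW'.eventually (by simp)
  have e4 : ∀ᶠ z in 𝓝 ((0 : ℝ), (0 : Fin m → ℝ)), Q (W (z, φ z)) :=
    (hW.continuousAt.tendsto.comp hpt).eventually hQ
  have e := (((e1.and e2).and (e3.and e4)).and hφe)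
  rw [nhds_prod_eq] at e
  -- One `ε > 0` is fixed for which everything holds for all `y` near `0`.
  have e' := e.curry.filter_mono (nhdsWithin_le_nhds (s := Set.Ioi 0))
  obtain ⟨ε, hε, hpos⟩ := (e'.and self_mem_nhdsWithin).exists
  have hpos : 0 < ε := hpos
  have h00 := hε.self_of_nhds
  have hscale : Tendsto (fun v : Fin m → ℝ => ε⁻¹ • v) (𝓝 0) (𝓝 0) := by
    have : Continuous (fun v : Fin m → ℝ => ε⁻¹ • v) := by fun_prop
    simpa using this.tendsto 0
  refine ⟨ε, hpos, fun v => φ (ε, ε⁻¹ • v), ⟨?_, ?_⟩, ?_⟩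
  · have h1 := h00.1.2.1
    refine ContDiffAt.const_smul (r ε) ?_
    have h2 : ContDiffAt ℝ 1 (fun z => W (z, φ z))
        ((fun v : Fin m → ℝ => (ε, ε⁻¹ • v)) 0) := by simpa using h1
    have h3 : ContDiffAt ℝ 1 (fun v : Fin m → ℝ => (ε, ε⁻¹ • v)) 0 := by fun_prop
    exact ContDiffAt.comp (g := fun z => W (z, φ z)) 0 h2 h3
  · filter_upwards [hscale.eventually hε] with v hv
    have := hv.1.1.1 hpos hv.2 hv.1.1.2
    simpa [smul_smul, hpos.ne'] using this
  · simpa using h00.1.2.2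

/-! ### Insertions in the limit of stiff links -/

namespace RealizableFamily

variable {m : ℕ} {lam : Fin m → ℝ} {s : Fin m → ℕ} {Ms Ms' : List ℝ}
  {w : (Fin m → ℝ) → Fin m → ℝ}

theorem contDiffAt_apply_smul {J : ℕ} (h : RealizableFamily lam s Ms J w) (x₀ : Fin m → ℝ)
    (i : Fin m) :
    ContDiffAt ℝ 1 (fun z : (ℝ × (Fin m → ℝ)) × (Fin m → ℝ) => w (z.1.1 • z.2) i)
      ((0, 0), x₀) := by
  have h1 : ContDiffAt ℝ 1 w ((fun z : (ℝ × (Fin m → ℝ)) × (Fin m → ℝ) => z.1.1 • z.2)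
      ((0, 0), x₀)) := by simpa using h.1
  have h3 : ContDiffAt ℝ 1 (fun z : (ℝ × (Fin m → ℝ)) × (Fin m → ℝ) => z.1.1 • z.2)
      ((0, 0), x₀) := by fun_prop
  have h2 := ContDiffAt.comp (g := w) ((0, 0), x₀) h1 h3
  exact contDiffAt_pi.1 h2 i

/-- The link is `c (λ) = (λⱼ - λ) / ε + S`: stiff away from `λⱼ`, so that `w' ≈ w + M` at higher
indices, and equal to `S` at `λⱼ`. -/
theorem create_stiff {j : Fin m} (h : RealizableFamily lam s Ms j w) (hpos : ∀ i, 0 < lam i)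
    (hlam : StrictMono lam) {M : ℝ} (hM : 0 < M) (hw : ∀ i, j ≤ i → 0 ≤ w 0 i) :
    ∃ w', RealizableFamily lam s (M :: Ms) (j + 1) w' ∧ ∀ i, j < i → 0 ≤ w' 0 i := by
  let U : Fin m → (ℝ × (Fin m → ℝ)) × (Fin m → ℝ) → ℝ := fun i z => w (z.1.1 • z.2) i
  have hU : ∀ i (z : (ℝ × (Fin m → ℝ)) × (Fin m → ℝ)), w (z.1.1 • z.2) i = U i z := fun _ _ => rfl
  have hU0 : ∀ i x, U i ((0, 0), x) = w 0 i := fun i x => by simp [U]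
  let x₀ : Fin m → ℝ := fun l => if l < j then lam l / (lam j - lam l) else 0
  -- Solves `1 / (w j + M) - λⱼ / S = ε yⱼ`.
  let S : (ℝ × (Fin m → ℝ)) × (Fin m → ℝ) → ℝ := fun z =>
    lam j / (1 / (M + U j z) - z.1.1 * z.1.2 j)
  let Y : Fin m → (ℝ × (Fin m → ℝ)) × (Fin m → ℝ) → ℝ := fun l z =>
    z.1.2 l + lam l / (lam j - lam l + z.1.1 * S z)
  let Φ : (ℝ × (Fin m → ℝ)) × (Fin m → ℝ) → Fin m → ℝ := fun z l =>
    if l < j then Y l z / (1 - z.1.1 * M * Y l z) else 0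
  let W : (ℝ × (Fin m → ℝ)) × (Fin m → ℝ) → Fin m → ℝ := fun z i =>
    if j < i then (lam j - lam i + z.1.1 * S z) * (U i z + M) /
      (lam j - lam i + z.1.1 * S z - z.1.1 * lam i * (U i z + M)) else 0
  have hc : ∀ i, ContDiffAt ℝ 1 (U i) ((0, 0), x₀) := h.contDiffAt_apply_smul x₀
  have hwj : 0 < M + w 0 j := by linarith [hw j le_rfl]
  have hS : ContDiffAt ℝ 1 S ((0, 0), x₀) := by
    have := hc j
    refine contDiffAt_const.div ((contDiffAt_const.div (by fun_prop) ?_).sub (by fun_prop)) ?_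
    · simpa [hU0] using hwj.ne'
    · simpa [hU0] using hwj.ne'
  have hS0 : 0 < S ((0, 0), x₀) := by
    simpa [S, hU0] using mul_pos (hpos j) hwj
  have hY : ∀ l, l < j → ContDiffAt ℝ 1 (Y l) ((0, 0), x₀) := fun l hl => by
    refine ContDiffAt.add (by fun_prop) (contDiffAt_const.div (by fun_prop) ?_)
    simpa using (sub_pos.2 (hlam hl)).ne'
  have hΦ : ContDiffAt ℝ 1 Φ ((0, 0), x₀) := by
    refine contDiffAt_pi.2 fun l => ?_
    by_cases hl : l < j
    · simp only [Φ, hl, if_true]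
      have := hY l hl
      exact this.div (by fun_prop) (by simp)
    · simp only [Φ, hl, if_false]
      exact contDiffAt_const
  have hW : ContDiffAt ℝ 1 W ((0, 0), x₀) := by
    refine contDiffAt_pi.2 fun i => ?_
    by_cases hi : j < i
    · simp only [W, hi, if_true]
      have := hc i
      refine ContDiffAt.div (by fun_prop) (by fun_prop) ?_
      simpa using (sub_neg.2 (hlam hi)).ne
    · simp only [W, hi, if_false]
      exact contDiffAt_const
  have hW0 : ∀ i, j < i → W ((0, 0), x₀) i = w 0 i + M := fun i hi => by
    have : lam j - lam i ≠ 0 := (sub_neg.2 (hlam hi)).ne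
    simp [W, hi, this, hU0]
  have hQ : ∀ᶠ z in 𝓝 (W ((0, 0), x₀)), ∀ i, j < i → 0 < z i := by
    refine eventually_all.2 fun i => ?_
    by_cases hi : j < i
    · have h1 : 0 < W ((0, 0), x₀) i := by rw [hW0 i hi]; linarith [hw i hi.le]
      filter_upwards [(continuous_apply i).continuousAt.eventually (lt_mem_nhds h1)] with z hz _
      exact hz
    · exact Eventually.of_forall fun z h => absurd h hi
  have hstep : ∀ᶠ z : (ℝ × (Fin m → ℝ)) × (Fin m → ℝ) in 𝓝 ((0, 0), x₀), 0 < z.1.1 → z.2 = Φ z →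
      Realizable lam s Ms j (z.1.1 • z.2) (w (z.1.1 • z.2)) →
      Realizable lam s (M :: Ms) (j + 1) (z.1.1 • z.1.2) ((1 : ℝ) • W z) := by
    have e1 : ∀ᶠ z in 𝓝 ((0, 0), x₀), 0 < S z := hS.continuousAt.eventually (lt_mem_nhds hS0)
    have e2 : ∀ᶠ z in 𝓝 ((0, 0), x₀), 0 < M + U j z := by
      have h1 : ContinuousAt (fun z : (ℝ × (Fin m → ℝ)) × (Fin m → ℝ) => M + U j z)
        ((0, 0), x₀) := ((hc j).continuousAt).const_add M
      exact h1.eventually (lt_mem_nhds (by simpa [hU0] using hwj))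
    have e3 : ∀ᶠ z in 𝓝 ((0, 0), x₀), ∀ l, l < j → 0 < lam j - lam l + z.1.1 * S z := by
      refine eventually_all.2 fun l => eventually_imp_distrib_left.2 fun hl => ?_
      have h1 : ContDiffAt ℝ 1 (fun z : (ℝ × (Fin m → ℝ)) × (Fin m → ℝ) =>
        lam j - lam l + z.1.1 * S z) ((0, 0), x₀) := by fun_prop
      exact h1.continuousAt.eventually (lt_mem_nhds (by simpa using hlam hl))
    have e4 : ∀ᶠ z in 𝓝 ((0, 0), x₀), ∀ l, l < j → 0 < 1 - z.1.1 * M * Y l z := by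
      refine eventually_all.2 fun l => eventually_imp_distrib_left.2 fun hl => ?_
      have := hY l hl
      have h1 : ContDiffAt ℝ 1 (fun z : (ℝ × (Fin m → ℝ)) × (Fin m → ℝ) =>
        1 - z.1.1 * M * Y l z) ((0, 0), x₀) := by fun_prop
      exact h1.continuousAt.eventually (lt_mem_nhds (by simp))
    have e5 : ∀ᶠ z in 𝓝 ((0, 0), x₀), ∀ i, j < i →
        lam j - lam i + z.1.1 * S z - z.1.1 * lam i * (U i z + M) < 0 := by
      refine eventually_all.2 fun i => eventually_imp_distrib_left.2 fun hi => ?_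
      have := hc i
      have h1 : ContDiffAt ℝ 1 (fun z : (ℝ × (Fin m → ℝ)) × (Fin m → ℝ) =>
        lam j - lam i + z.1.1 * S z - z.1.1 * lam i * (U i z + M)) ((0, 0), x₀) := by
        fun_prop
      exact h1.continuousAt.eventually (gt_mem_nhds (by simpa using hlam hi))
    filter_upwards [e1, e2, e3, e4, e5] with z h1 h2 h3 h4 h5 hz hx hR
    have hz' := hz.ne'
    have hcl : ∀ i, lam j / z.1.1 + S z - lam i * (1 / z.1.1) =
        (lam j - lam i + z.1.1 * S z) / z.1.1 := fun i => by
      field_simp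
      ring
    have hSe : lam j / S z = 1 / (M + U j z) - z.1.1 * z.1.2 j := by
      have h6 : S z = lam j / (1 / (M + U j z) - z.1.1 * z.1.2 j) := rfl
      have h7 := (hpos j).ne'
      rw [h6, div_div_cancel₀ h7]
    refine hR.create (μ := M) (k := lam j / z.1.1 + S z) (b := 1 / z.1.1) hM
      (add_pos (div_pos (hpos j) hz) h1) (by positivity) (Or.inr rfl) ?_ ?_ ?_ <;> try simp only [hU]
    · intro l hl
      have hxl : z.2 l = Y l z / (1 - z.1.1 * M * Y l z) := by
        have := congrFun hx l
        simpa [Φ, hl] using this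
      have h6 := (h3 l hl).ne'
      have h7 := (h4 l hl).ne'
      have h8 : 1 + M * (z.1.1 • z.2) l = 1 / (1 - z.1.1 * M * Y l z) := by
        simp only [Pi.smul_apply, smul_eq_mul, hxl]
        generalize Y l z = y at h7 ⊢
        rw [eq_div_iff h7, add_mul, mul_assoc M, mul_assoc z.1.1 _ (1 - _), div_mul_cancel₀ _ h7]
        ring
      rw [hcl, h8]
      refine ⟨div_ne_zero h6 hz', one_div_ne_zero h7, ?_⟩
      have h9 : Y l z = z.1.2 l + lam l / (lam j - lam l + z.1.1 * S z) := rfl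
      simp only [Pi.smul_apply, smul_eq_mul, hxl]
      generalize hd : 1 - z.1.1 * M * Y l z = d at h7 ⊢
      rw [h9]
      generalize lam j - lam l + z.1.1 * S z = e at h6 ⊢
      field_simp
      ring
    · rw [hcl, sub_self, zero_add, mul_div_cancel_left₀ _ hz']
      refine ⟨h1.ne', by linarith, ?_⟩
      rw [hSe, add_comm M]
      simp
    · intro i hi
      have h6 := (h5 i hi).ne
      rw [hcl]
      have h7 : (lam j - lam i + z.1.1 * S z) / z.1.1 - lam i * (U i z + M) =
          (lam j - lam i + z.1.1 * S z - z.1.1 * lam i * (U i z + M)) / z.1.1 := by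
        field_simp
      rw [h7]
      refine ⟨div_ne_zero h6 hz', ?_⟩
      simp only [W, hi, if_true, Pi.smul_apply, smul_eq_mul, one_mul]
      generalize lam j - lam i + z.1.1 * S z - z.1.1 * lam i * (U i z + M) = d at h6 ⊢
      field_simp
  obtain ⟨ε, hε, φ, hF, hφ⟩ := h.perturb (Φ := Φ) (W := W) (x₀ := x₀) (s' := s) (Ms' := M :: Ms)
    (J' := j + 1) (fun _ => 1) hΦ
    (fun x => by
      funext l
      by_cases hl : l < j <;> simp [Φ, Y, x₀, hl]) hW hstep hQ
  · refine ⟨_, hF, fun i hi => ?_⟩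
    simpa using (hφ i hi).le

/-- With `B = 1 / ε` the values become `w' ≈ w - w i`. Their order is preserved and index `i` moves
to `0`, so lower uncreated indices become negative and can be hit next. -/
theorem hit {J : ℕ} (h : RealizableFamily lam s Ms J w) (hpos : ∀ i, 0 < lam i)
    (hlam : StrictMono lam) {i : Fin m} (hi : J ≤ i) (hwi : w 0 i < 0)
    (hmono : ∀ a b : Fin m, J ≤ a → a < b → w 0 a < w 0 b)
    (hMs : ∀ᶠ v in 𝓝 0, Ms' = Ms ∨ Ms' = -w v i :: Ms) :
    ∃ w', RealizableFamily lam (s + Pi.single i 1) Ms' J w' ∧ w' 0 i = 0 ∧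
      ∀ a b : Fin m, J ≤ a → a < b → w' 0 a < w' 0 b := by
  have hne : ∀ l, l ≠ i → lam i - lam l ≠ 0 := fun l hl h =>
    hl (hlam.injective (sub_eq_zero.1 h).symm)
  let U : Fin m → (ℝ × (Fin m → ℝ)) × (Fin m → ℝ) → ℝ := fun i z => w (z.1.1 • z.2) i
  have hU : ∀ i (z : (ℝ × (Fin m → ℝ)) × (Fin m → ℝ)), w (z.1.1 • z.2) i = U i z := fun _ _ => rfl
  have hU0 : ∀ i x, U i ((0, 0), x) = w 0 i := fun i x => by simp [U]
  let x₀ : Fin m → ℝ := fun l => if (l : ℕ) < J then lam l / (lam i - lam l) else 0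
  let Y : Fin m → (ℝ × (Fin m → ℝ)) × (Fin m → ℝ) → ℝ := fun l z =>
    z.1.2 l + lam l / (lam i - lam l)
  let Φ : (ℝ × (Fin m → ℝ)) × (Fin m → ℝ) → Fin m → ℝ := fun z l =>
    if (l : ℕ) < J then Y l z / (1 + z.1.1 * U i z * Y l z) else 0
  let W : (ℝ × (Fin m → ℝ)) × (Fin m → ℝ) → Fin m → ℝ := fun z l =>
    if l ≠ i then (lam i - lam l) * (U l z - U i z) /
      (lam i - lam l - z.1.1 * lam l * (U l z - U i z)) else 0
  have hc : ∀ i, ContDiffAt ℝ 1 (U i) ((0, 0), x₀) := h.contDiffAt_apply_smul x₀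
  have hci := hc i
  have hY : ∀ l, ContDiffAt ℝ 1 (Y l) ((0, 0), x₀) := fun l => by
    simp only [Y]
    fun_prop
  have hΦ : ContDiffAt ℝ 1 Φ ((0, 0), x₀) := by
    refine contDiffAt_pi.2 fun l => ?_
    by_cases hl : (l : ℕ) < J
    · simp only [Φ, hl, if_true]
      have := hY l
      exact this.div (by fun_prop) (by simp)
    · simp only [Φ, hl, if_false]
      exact contDiffAt_const
  have hW : ContDiffAt ℝ 1 W ((0, 0), x₀) := by
    refine contDiffAt_pi.2 fun l => ?_
    by_cases hl : l ≠ i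
    · simp only [W, hl, if_true, not_false_eq_true, ne_eq]
      have := hc l
      refine ContDiffAt.div (by fun_prop) (by fun_prop) ?_
      simpa using hne l hl
    · simp only [W, hl, if_false]
      exact contDiffAt_const
  have hW0 : ∀ l, W ((0, 0), x₀) l = w 0 l - w 0 i := fun l => by
    by_cases hl : l = i
    · simp [W, hl]
    · simp [W, hl, hne l hl, hU0]
  have hQ : ∀ᶠ z in 𝓝 (W ((0, 0), x₀)), ∀ a b : Fin m, J ≤ a → a < b → z a < z b := by
    refine eventually_all.2 fun a => eventually_all.2 fun b =>
      eventually_imp_distrib_left.2 fun ha => eventually_imp_distrib_left.2 fun hab => ?_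
    refine (continuous_apply a).continuousAt.eventually_lt (continuous_apply b).continuousAt ?_
    rw [hW0, hW0]
    linarith [hmono a b ha hab]
  have hstep : ∀ᶠ z : (ℝ × (Fin m → ℝ)) × (Fin m → ℝ) in 𝓝 ((0, 0), x₀), 0 < z.1.1 → z.2 = Φ z →
      Realizable lam s Ms J (z.1.1 • z.2) (w (z.1.1 • z.2)) →
      Realizable lam (s + Pi.single i 1) Ms' J (z.1.1 • z.1.2) ((1 : ℝ) • W z) := by
    have hsm : Tendsto (fun z : (ℝ × (Fin m → ℝ)) × (Fin m → ℝ) => z.1.1 • z.2) (𝓝 ((0, 0), x₀))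
        (𝓝 0) := by
      have : Continuous (fun z : (ℝ × (Fin m → ℝ)) × (Fin m → ℝ) => z.1.1 • z.2) := by fun_prop
      simpa using this.tendsto ((0, 0), x₀)
    have e1 := hsm.eventually hMs
    have e2 : ∀ᶠ z in 𝓝 ((0, 0), x₀), U i z < 0 :=
      hci.continuousAt.eventually (gt_mem_nhds (by simpa [hU0] using hwi))
    have e4 : ∀ᶠ z in 𝓝 ((0, 0), x₀), ∀ l, 0 < 1 + z.1.1 * U i z * Y l z := by
      refine eventually_all.2 fun l => ?_
      have := hY l
      have h1 : ContDiffAt ℝ 1 (fun z : (ℝ × (Fin m → ℝ)) × (Fin m → ℝ) =>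
        1 + z.1.1 * U i z * Y l z) ((0, 0), x₀) := by fun_prop
      exact h1.continuousAt.eventually (lt_mem_nhds (by simp))
    have e5 : ∀ᶠ z in 𝓝 ((0, 0), x₀), ∀ l, l ≠ i →
        lam i - lam l - z.1.1 * lam l * (U l z - U i z) ≠ 0 := by
      refine eventually_all.2 fun l => eventually_imp_distrib_left.2 fun hl => ?_
      have := hc l
      have h1 : ContDiffAt ℝ 1 (fun z : (ℝ × (Fin m → ℝ)) × (Fin m → ℝ) =>
        lam i - lam l - z.1.1 * lam l * (U l z - U i z)) ((0, 0), x₀) := by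
        fun_prop
      exact h1.continuousAt.eventually_ne (by simpa using hne l hl)
    filter_upwards [e1, e2, e4, e5] with z h1 h2 h4 h5 hz hx hR
    have hz' := hz.ne'
    refine hR.hit hpos hlam.injective hi h2 (B := 1 / z.1.1) (by positivity) h1 ?_ ?_ (by simp [W]) <;> try simp only [hU]
    · intro l hl
      have hli : l ≠ i := by rintro rfl; omega
      have hxl : z.2 l = Y l z / (1 + z.1.1 * U i z * Y l z) := by
        have := congrFun hx l
        simpa [Φ, hl] using this
      have h7 := (h4 l).ne'
      have h8 : 1 - U i z * (z.1.1 • z.2) l =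
          1 / (1 + z.1.1 * U i z * Y l z) := by
        rw [Pi.smul_apply z.1.1 z.2 l, smul_eq_mul, hxl]
        generalize Y l z = y at h7 ⊢
        generalize U i z = a at h7 ⊢
        rw [eq_div_iff h7, sub_mul, mul_assoc a, mul_assoc z.1.1 _ (1 + _), div_mul_cancel₀ _ h7]
        ring
      rw [h8]
      refine ⟨one_div_ne_zero h7, ?_⟩
      have h9 : Y l z = z.1.2 l + lam l / (lam i - lam l) := rfl
      have h6 := hne l hli
      rw [Pi.smul_apply z.1.1 z.2 l, Pi.smul_apply z.1.1 z.1.2 l, smul_eq_mul, smul_eq_mul, hxl]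
      generalize 1 + z.1.1 * U i z * Y l z = d at h7 ⊢
      rw [h9]
      generalize lam i - lam l = e at h6 ⊢
      field_simp
      ring
    · intro l _ hli
      have h6 := h5 l hli
      have h7 : 1 / z.1.1 * (lam i - lam l) - lam l * (U l z - U i z) =
          (lam i - lam l - z.1.1 * lam l * (U l z - U i z)) / z.1.1 := by
        field_simp
      rw [h7]
      refine ⟨div_ne_zero h6 hz', ?_⟩
      simp only [W, hli, ne_eq, not_false_eq_true, if_true, one_smul]
      generalize lam i - lam l - z.1.1 * lam l * (U l z - U i z) = d at h6 ⊢
      field_simp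
  obtain ⟨ε, hε, φ, hF, hφ⟩ := h.perturb (Φ := Φ) (W := W) (x₀ := x₀)
    (s' := s + Pi.single i 1) (Ms' := Ms') (J' := J) (fun _ => 1) hΦ
    (fun x => by
      funext l
      by_cases hl : (l : ℕ) < J <;> simp [Φ, Y, x₀, hl]) hW hstep hQ
  · exact ⟨_, hF, by simp [W], by simpa using hφ⟩

end RealizableFamily

namespace RealizableFamily

variable {m : ℕ} {lam : Fin m → ℝ} {s : Fin m → ℕ} {Ms Ms' : List ℝ}
  {w : (Fin m → ℝ) → Fin m → ℝ}

/-- A huge auxiliary mass `1 / ε - w i` swamps the old values, so their signs and order do not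
matter. The link is determined by its values at `λⱼ` and `λᵢ`, divided by `ε`: `cj` gives `v' j = ε
yⱼ`, and `ci` gives `w' i = -M` for every `v`, so that the following hit inserts a mass exactly `M`.
-/
theorem create_before_hit {j i : Fin m} (h : RealizableFamily lam s Ms j w) (hji : j < i)
    (hpos : ∀ i, 0 < lam i) (hlam : StrictMono lam) {M : ℝ} (hM : 0 < M) :
    ∃ w', RealizableFamily lam s Ms (j + 1) w' ∧ (∀ v, w' v i = -M) ∧
      ∀ a b, j < a → a < b → w' 0 a < w' 0 b := by
  let U : Fin m → (ℝ × (Fin m → ℝ)) × (Fin m → ℝ) → ℝ := fun i z => w (z.1.1 • z.2) i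
  have hU : ∀ i (z : (ℝ × (Fin m → ℝ)) × (Fin m → ℝ)), w (z.1.1 • z.2) i = U i z := fun _ _ => rfl
  have hU0 : ∀ i x, U i ((0, 0), x) = w 0 i := fun i x => by simp [U]
  let G : Fin m → (ℝ × (Fin m → ℝ)) × (Fin m → ℝ) → ℝ := fun l z => 1 + z.1.1 * (U l z - U i z)
  let cj : (ℝ × (Fin m → ℝ)) × (Fin m → ℝ) → ℝ := fun z => lam j / (1 / G j z - z.1.2 j)
  let ci : (ℝ × (Fin m → ℝ)) × (Fin m → ℝ) → ℝ := fun z =>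
    lam i * (M * z.1.1 / (1 + M * z.1.1))
  let c : Fin m → (ℝ × (Fin m → ℝ)) × (Fin m → ℝ) → ℝ := fun l z =>
    (cj z * (lam i - lam l) + ci z * (lam l - lam j)) / (lam i - lam j)
  let c₀ : Fin m → ℝ := fun l => lam j * (lam i - lam l) / (lam i - lam j)
  let Y : Fin m → (ℝ × (Fin m → ℝ)) × (Fin m → ℝ) → ℝ := fun l z => z.1.2 l + lam l / c l z
  let x₀ : Fin m → ℝ := fun l => if l < j then lam l / c₀ l / (1 - lam l / c₀ l) else 0
  let Φ : (ℝ × (Fin m → ℝ)) × (Fin m → ℝ) → Fin m → ℝ := fun z l =>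
    if l < j then Y l z / (1 - Y l z + z.1.1 * Y l z * U i z) else 0
  let W : (ℝ × (Fin m → ℝ)) × (Fin m → ℝ) → Fin m → ℝ := fun z l =>
    if l = i then -(z.1.1 * M) else if j < l then c l z * G l z / (c l z - lam l * G l z) else 0
  have hij : 0 < lam i - lam j := sub_pos.2 (hlam hji)
  have hij' := hij.ne'
  have hG0 : ∀ l x, G l ((0, 0), x) = 1 := fun l x => by simp [G]
  have hcj0 : ∀ x, cj ((0, 0), x) = lam j := fun x => by simp [cj, hG0]
  have hci0 : ∀ x, ci ((0, 0), x) = 0 := fun x => by simp [ci]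
  have hc0 : ∀ l x, c l ((0, 0), x) = c₀ l := fun l x => by simp [c, hcj0, hci0, c₀]
  have hc₀pos : ∀ l, l < j → 0 < c₀ l := fun l hl =>
    div_pos (mul_pos (hpos j) (sub_pos.2 (hlam (hl.trans hji)))) hij
  have hc₀lt : ∀ l, l < j → lam l < c₀ l := fun l hl => by
    have h1 : c₀ l - lam l = lam i * (lam j - lam l) / (lam i - lam j) := by
      simp only [c₀]; field_simp; ring
    have h2 : 0 < lam i * (lam j - lam l) / (lam i - lam j) :=
      div_pos (mul_pos (hpos i) (sub_pos.2 (hlam hl))) hij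
    linarith
  have hc₀gt : ∀ l, j < l → c₀ l - lam l = -(lam i * (lam l - lam j) / (lam i - lam j)) :=
    fun l hl => by simp only [c₀]; field_simp; ring
  have hc₀gt' : ∀ l, j < l → c₀ l - lam l < 0 := fun l hl => by
    rw [hc₀gt l hl]
    exact neg_neg_of_pos (div_pos (mul_pos (hpos i) (sub_pos.2 (hlam hl))) hij)
  have hY0 : ∀ l x, Y l ((0, 0), x) = lam l / c₀ l := fun l x => by simp [Y, hc0]
  have hY1 : ∀ l, l < j → 0 < 1 - lam l / c₀ l := fun l hl => by
    rw [sub_pos, div_lt_one (hc₀pos l hl)]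
    exact hc₀lt l hl
  have hUc : ∀ i, ContDiffAt ℝ 1 (U i) ((0, 0), x₀) := h.contDiffAt_apply_smul x₀
  have hGc : ∀ l, ContDiffAt ℝ 1 (G l) ((0, 0), x₀) := fun l => by
    have := hUc l
    have := hUc i
    simp only [G]
    fun_prop
  have hcjc : ContDiffAt ℝ 1 cj ((0, 0), x₀) := by
    have := hGc j
    refine contDiffAt_const.div ((contDiffAt_const.div (by fun_prop) ?_).sub (by fun_prop)) ?_
    · simp [hG0]
    · simp [hG0]
  have hcic : ContDiffAt ℝ 1 ci ((0, 0), x₀) :=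
    contDiffAt_const.mul (ContDiffAt.div (by fun_prop) (by fun_prop) (by simp))
  have hcc : ∀ l, ContDiffAt ℝ 1 (c l) ((0, 0), x₀) := fun l => by
    simp only [c]
    fun_prop
  have hYc : ∀ l, l < j → ContDiffAt ℝ 1 (Y l) ((0, 0), x₀) := fun l hl => by
    have := hcc l
    refine ContDiffAt.add (by fun_prop) (contDiffAt_const.div (by fun_prop) ?_)
    rw [hc0]
    exact (hc₀pos l hl).ne'
  have hDc : ∀ l, l < j → ContDiffAt ℝ 1 (fun z : (ℝ × (Fin m → ℝ)) × (Fin m → ℝ) =>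
      1 - Y l z + z.1.1 * Y l z * U i z) ((0, 0), x₀) := fun l hl => by
    have := hYc l hl
    have := hUc i
    fun_prop
  have hΦ : ContDiffAt ℝ 1 Φ ((0, 0), x₀) := by
    refine contDiffAt_pi.2 fun l => ?_
    by_cases hl : l < j
    · simp only [Φ, hl, if_true]
      refine (hYc l hl).div (hDc l hl) ?_
      simpa [hY0] using (hY1 l hl).ne'
    · simp only [Φ, hl, if_false]
      exact contDiffAt_const
  have hEc : ∀ l, ContDiffAt ℝ 1 (fun z : (ℝ × (Fin m → ℝ)) × (Fin m → ℝ) =>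
      c l z - lam l * G l z) ((0, 0), x₀) := fun l => by
    have := hcc l
    have := hGc l
    fun_prop
  have hW : ContDiffAt ℝ 1 W ((0, 0), x₀) := by
    refine contDiffAt_pi.2 fun l => ?_
    by_cases hli : l = i
    · simp only [W, hli, if_true]
      fun_prop
    · by_cases hl : j < l
      · simp only [W, hl, hli, if_true, if_false]
        refine ((hcc l).mul (hGc l)).div (hEc l) ?_
        simpa [hc0, hG0] using (hc₀gt' l hl).ne
      · simp only [W, hl, hli, if_false]
        exact contDiffAt_const
  have hW0 : ∀ l, j < l → W ((0, 0), x₀) l = lam j / lam i * ((lam l - lam i) / (lam l - lam j)) :=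
    fun l hl => by
    by_cases hli : l = i
    · simp [W, hli]
    · have h1 : 0 < lam l - lam j := sub_pos.2 (hlam hl)
      have h2 := h1.ne'
      have h3 := (hpos i).ne'
      simp only [W, hli, hl, if_true, if_false, hc0, hG0, mul_one, hc₀gt l hl]
      simp only [c₀]
      generalize lam l - lam j = x at h2 ⊢
      generalize lam i - lam j = y at hij' ⊢
      field_simp
      ring
  have hQ : ∀ᶠ z in 𝓝 (W ((0, 0), x₀)), ∀ a b, j < a → a < b → z a < z b := by
    refine eventually_all.2 fun a => eventually_all.2 fun b =>
      eventually_imp_distrib_left.2 fun ha => eventually_imp_distrib_left.2 fun hab => ?_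
    refine (continuous_apply a).continuousAt.eventually_lt (continuous_apply b).continuousAt ?_
    rw [hW0 a ha, hW0 b (ha.trans hab)]
    -- The limit profile is a positive multiple of `1 - (λᵢ - λⱼ) / (λ - λⱼ)`, increasing for `λ >
    -- λⱼ`.
    refine mul_lt_mul_of_pos_left ?_ (div_pos (hpos j) (hpos i))
    have h1 := sub_pos.2 (hlam ha)
    have h2 := sub_pos.2 (hlam hab)
    rw [div_lt_div_iff₀ h1 (by linarith)]
    nlinarith
  have hstep : ∀ᶠ z : (ℝ × (Fin m → ℝ)) × (Fin m → ℝ) in 𝓝 ((0, 0), x₀), 0 < z.1.1 → z.2 = Φ z →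
      Realizable lam s Ms j (z.1.1 • z.2) (w (z.1.1 • z.2)) →
      Realizable lam s Ms (j + 1) (z.1.1 • z.1.2) (z.1.1⁻¹ • W z) := by
    have e1 : ∀ᶠ z in 𝓝 ((0, 0), x₀), ∀ l, l < j → 0 < c l z := by
      refine eventually_all.2 fun l => eventually_imp_distrib_left.2 fun hl => ?_
      exact (hcc l).continuousAt.eventually (lt_mem_nhds (by rw [hc0]; exact hc₀pos l hl))
    have e2 : ∀ᶠ z in 𝓝 ((0, 0), x₀), ∀ l, l < j → 0 < 1 - Y l z + z.1.1 * Y l z * U i z := by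
      refine eventually_all.2 fun l => eventually_imp_distrib_left.2 fun hl => ?_
      refine (hDc l hl).continuousAt.eventually (lt_mem_nhds ?_)
      simpa only [hY0, zero_mul, add_zero] using hY1 l hl
    have e3 : ∀ᶠ z in 𝓝 ((0, 0), x₀), ∀ l, j < l → c l z - lam l * G l z < 0 := by
      refine eventually_all.2 fun l => eventually_imp_distrib_left.2 fun hl => ?_
      refine (hEc l).continuousAt.eventually (gt_mem_nhds ?_)
      simpa only [hc0, hG0, mul_one] using hc₀gt' l hl
    have e4 : ∀ᶠ z in 𝓝 ((0, 0), x₀), 0 < G j z :=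
      (hGc j).continuousAt.eventually (lt_mem_nhds (by simp [hG0]))
    have e5 : ∀ᶠ z in 𝓝 ((0, 0), x₀), 0 < cj z :=
      hcjc.continuousAt.eventually (lt_mem_nhds (by simpa only [hcj0] using hpos j))
    have e6 : ∀ᶠ z in 𝓝 ((0, 0), x₀), 0 < cj z * lam i - ci z * lam j := by
      have h1 : ContDiffAt ℝ 1 (fun z => cj z * lam i - ci z * lam j) ((0, 0), x₀) := by fun_prop
      refine h1.continuousAt.eventually (lt_mem_nhds ?_)
      simpa only [hcj0, hci0, zero_mul, sub_zero] using mul_pos (hpos j) (hpos i)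
    have e7 : ∀ᶠ z in 𝓝 ((0, 0), x₀), ci z < cj z :=
      hcic.continuousAt.eventually_lt hcjc.continuousAt (by simpa only [hcj0, hci0] using hpos j)
    have e8 : ∀ᶠ z in 𝓝 ((0, 0), x₀), 0 < 1 - z.1.1 * U i z := by
      have := hUc i
      have h1 : ContDiffAt ℝ 1 (fun z : (ℝ × (Fin m → ℝ)) × (Fin m → ℝ) =>
        1 - z.1.1 * U i z) ((0, 0), x₀) := by fun_prop
      exact h1.continuousAt.eventually (lt_mem_nhds (by simp))
    filter_upwards [e1, e2, e3, e4, e5, e6, e7, e8] with z h1 h2 h3 h4 h5 h6 h7 h8 hz hx hR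
    have hz' := hz.ne'
    have hcl : ∀ l, (cj z * lam i - ci z * lam j) / (lam i - lam j) / z.1.1 -
        lam l * ((cj z - ci z) / (lam i - lam j) / z.1.1) = c l z / z.1.1 := fun l => by
      simp only [c]
      generalize lam i - lam j = d at hij' ⊢
      field_simp
      ring
    have hμ : ∀ l, U l z + (1 - z.1.1 * U i z) / z.1.1 = G l z / z.1.1 := fun l => by
      simp only [G]
      field_simp
      ring
    have hcje : lam j / cj z = 1 / G j z - z.1.2 j := by
      have h9 : cj z = lam j / (1 / G j z - z.1.2 j) := rfl
      rw [h9, div_div_cancel₀ (hpos j).ne']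
    have hcij : c j z = cj z := by
      simp only [c, sub_self, mul_zero, add_zero]
      field_simp
    refine hR.create (μ := (1 - z.1.1 * U i z) / z.1.1)
      (k := (cj z * lam i - ci z * lam j) / (lam i - lam j) / z.1.1)
      (b := (cj z - ci z) / (lam i - lam j) / z.1.1) (div_pos h8 hz)
      (div_pos (div_pos h6 hij) hz) (div_pos (div_pos (sub_pos.2 h7) hij) hz).le (Or.inl rfl)
      ?_ ?_ ?_
    · intro l hl
      have hxl : z.2 l = Y l z / (1 - Y l z + z.1.1 * Y l z * U i z) := by
        have := congrFun hx l
        simpa [Φ, hl] using this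
      have h9 := (h2 l hl).ne'
      have h10 := (h1 l hl).ne'
      have h11 : 1 + (1 - z.1.1 * U i z) / z.1.1 * (z.1.1 • z.2) l =
          1 / (1 - Y l z + z.1.1 * Y l z * U i z) := by
        rw [Pi.smul_apply z.1.1 z.2 l, smul_eq_mul, hxl]
        generalize hd : 1 - Y l z + z.1.1 * Y l z * U i z = d at h9 ⊢
        field_simp
        rw [← hd]
        ring
      rw [hcl, h11]
      refine ⟨div_ne_zero h10 hz', one_div_ne_zero h9, ?_⟩
      have h12 : Y l z = z.1.2 l + lam l / c l z := rfl
      rw [Pi.smul_apply z.1.1 z.2 l, Pi.smul_apply z.1.1 z.1.2 l, smul_eq_mul, smul_eq_mul, hxl]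
      generalize 1 - Y l z + z.1.1 * Y l z * U i z = d at h9 ⊢
      rw [h12]
      generalize c l z = e at h10 ⊢
      field_simp
      ring
    · rw [hcl, hU, hμ, hcij]
      refine ⟨div_ne_zero h5.ne' hz', div_ne_zero h4.ne' hz', ?_⟩
      rw [Pi.smul_apply z.1.1 z.1.2 j, smul_eq_mul, one_div_div, div_div_eq_mul_div,
        mul_comm (lam j), mul_div_assoc, hcje]
      ring
    · intro l hl
      have h9 := (h3 l hl).ne
      rw [hcl, hU, hμ]
      have h10 : c l z / z.1.1 - lam l * (G l z / z.1.1) = (c l z - lam l * G l z) / z.1.1 := by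
        ring
      rw [h10]
      refine ⟨div_ne_zero h9 hz', ?_⟩
      rw [Pi.smul_apply z.1.1⁻¹ (W z) l, smul_eq_mul]
      by_cases hli : l = i
      · subst hli
        have h11 : c l z = lam l * (M * z.1.1 / (1 + M * z.1.1)) := by
          simp only [c, ci, sub_self, mul_zero, zero_add]
          field_simp
        have h12 : G l z = 1 := by simp [G]
        have h13 : 0 < 1 + M * z.1.1 := by positivity
        have h14 := (hpos l).ne'
        simp only [W, if_true]
        rw [h12, h11]
        have h15 : lam l * (M * z.1.1 / (1 + M * z.1.1)) - lam l * 1 =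
            -(lam l / (1 + M * z.1.1)) := by
          field_simp
          ring
        rw [h15]
        field_simp
      · simp only [W, hli, hl, if_true, if_false]
        generalize c l z - lam l * G l z = d at h9 ⊢
        field_simp
  obtain ⟨ε, hε, φ, hF, hφ⟩ := h.perturb (Φ := Φ) (W := W) (x₀ := x₀) (s' := s) (Ms' := Ms)
    (J' := j + 1) (fun ε => ε⁻¹) hΦ
    (fun x => by
      funext l
      by_cases hl : l < j <;> simp [Φ, hY0, x₀, hl]) hW hstep hQ
  refine ⟨_, hF, fun v => ?_, fun a b ha hab => ?_⟩
  · simp [W, hε.ne']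
  · have h1 := hφ a b ha hab
    simpa using mul_lt_mul_of_pos_left h1 (inv_pos.2 hε)

end RealizableFamily

/-! ### Schedule of the hits -/

/-- In phase `j` of the construction, an edge and a mass are inserted that raise the multiplicity of
the eigenvalue with index `i`. -/
def HitsAt {m : ℕ} (t : Fin m → ℕ) (j : ℕ) (i : Fin m) : Prop :=
  j < i ∧ (i : ℕ) < j + t i

/-- The number of phases before phase `j` that hit the eigenvalue with index `i`. -/
def hitCount {m : ℕ} (t : Fin m → ℕ) (j : ℕ) (i : Fin m) : ℕ :=
  min j i - (i + 1 - t i)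

theorem hitCount_succ_of_hitsAt {m : ℕ} {t : Fin m → ℕ} (ht : ∀ i, t i ≤ (i : ℕ) + 1) {j : ℕ}
    {i : Fin m} (h : HitsAt t j i) : hitCount t (j + 1) i = hitCount t j i + 1 := by
  have := ht i
  unfold HitsAt at h
  unfold hitCount
  omega

theorem hitCount_succ_of_not_hitsAt {m : ℕ} {t : Fin m → ℕ} {j : ℕ}
    {i : Fin m} (h : ¬ HitsAt t j i) : hitCount t (j + 1) i = hitCount t j i := by
  unfold HitsAt at h
  unfold hitCount
  omega

open Classical in
/-- `hitCount t j` plus the hits of phase `j` with index at least `q`. -/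
noncomputable def hitCountFrom {m : ℕ} (t : Fin m → ℕ) (j q : ℕ) (i : Fin m) : ℕ :=
  hitCount t j i + if HitsAt t j i ∧ q ≤ i then 1 else 0

theorem hitCountFrom_add_single {m : ℕ} {t : Fin m → ℕ} {j : ℕ} {i : Fin m}
    (h : HitsAt t j i) :
    hitCountFrom t j (i + 1) + Pi.single i 1 = hitCountFrom t j i := by
  funext l
  by_cases hl : l = i
  · subst hl
    simp [hitCountFrom, h]
  · have h1 : (i : ℕ) + 1 ≤ l ↔ (i : ℕ) ≤ l := by
      have : (l : ℕ) ≠ i := fun h => hl (Fin.ext h)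
      omega
    simp only [hitCountFrom, Pi.add_apply, Pi.single_eq_of_ne hl, add_zero]
    split_ifs <;> first | rfl | (exfalso; tauto)

theorem hitCountFrom_of_not_hitsAt {m : ℕ} {t : Fin m → ℕ} {j : ℕ} {i : Fin m}
    (h : ¬ HitsAt t j i) : hitCountFrom t j (i + 1) = hitCountFrom t j i := by
  funext l
  by_cases hl : l = i
  · subst hl
    simp [hitCountFrom, h]
  · have h1 : (i : ℕ) + 1 ≤ l ↔ (i : ℕ) ≤ l := by
      have : (l : ℕ) ≠ i := fun h => hl (Fin.ext h)
      omega
    simp only [hitCountFrom]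
    split_ifs <;> first | rfl | (exfalso; tauto)

theorem hitCountFrom_succ {m : ℕ} {t : Fin m → ℕ} (ht : ∀ i, t i ≤ (i : ℕ) + 1) (j : ℕ) :
    hitCountFrom t j (j + 1) = hitCount t (j + 1) := by
  funext i
  by_cases h : HitsAt t j i
  · have : j + 1 ≤ (i : ℕ) := h.1
    simp [hitCountFrom, h, this, hitCount_succ_of_hitsAt ht h]
  · simp [hitCountFrom, h, hitCount_succ_of_not_hitsAt h]

/-- Within a phase the hits go down in index: the last index hit has value `0`, so by monotonicity
every lower candidate is negative and gives a positive mass. The index `i₀` records the last hit. -/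
theorem exists_realizableFamily_of_hits {m : ℕ} {lam : Fin m → ℝ} (hpos : ∀ i, 0 < lam i)
    (hlam : StrictMono lam) {t : Fin m → ℕ} {Ms : List ℝ} {j : ℕ} {i₁ : Fin m}
    (d : ℕ) : ∀ q : ℕ, q + d = i₁ → j + 1 ≤ q →
    (∃ w, RealizableFamily lam (hitCountFrom t j i₁) Ms (j + 1) w ∧
      (∀ a b : Fin m, j + 1 ≤ a → a < b → w 0 a < w 0 b) ∧
      ∃ i₀, HitsAt t j i₀ ∧ i₁ ≤ i₀ ∧ w 0 i₀ = 0) →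
    ∃ w, RealizableFamily lam (hitCountFrom t j q) Ms (j + 1) w ∧
      (∀ a b : Fin m, j + 1 ≤ a → a < b → w 0 a < w 0 b) ∧
      ∃ i₀ : Fin m, HitsAt t j i₀ ∧ q ≤ i₀ ∧ w 0 i₀ = 0 := by
  induction d with
  | zero =>
    intro q hq _ h
    obtain rfl : q = i₁ := by omega
    exact h
  | succ d ih =>
    intro q hq hjq h
    obtain ⟨w, hw, hmono, i₀, hi₀, hqi, hz⟩ := ih (q + 1) (by omega) (by omega) h
    let i : Fin m := ⟨q, by omega⟩
    by_cases hi : HitsAt t j i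
    · have hneg : w 0 i < 0 := by
        rw [← hz]
        exact hmono i i₀ hjq (Fin.lt_def.2 hqi)
      obtain ⟨w', h1, h2, h3⟩ := hw.hit hpos hlam (i := i) hjq hneg hmono
        (Eventually.of_forall fun _ => Or.inl rfl)
      refine ⟨w', ?_, h3, i, hi, le_rfl, h2⟩
      have h4 := hitCountFrom_add_single hi
      exact h4 ▸ h1
    · refine ⟨w, ?_, hmono, i₀, hi₀, by omega, hz⟩
      have h4 := hitCountFrom_of_not_hitsAt hi
      exact h4 ▸ hw

theorem exists_realizableFamily {m : ℕ} {lam : Fin m → ℝ} (hpos : ∀ i, 0 < lam i)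
    (hlam : StrictMono lam) {t : Fin m → ℕ} (ht : ∀ i, t i ≤ (i : ℕ) + 1)
    {M : Fin m → ℝ} (hM : ∀ l, 0 < M l) (j : ℕ) (hj : j ≤ m) :
    ∃ w, RealizableFamily lam (hitCount t j) ((List.ofFn M).take j).reverse j w ∧
      ((∀ i, ¬ HitsAt t j i) → ∀ i : Fin m, j ≤ i → 0 ≤ w 0 i) := by
  induction j with
  | zero =>
    have h0 : hitCount t 0 = 0 := by
      funext i
      simp [hitCount]
    refine ⟨0, ⟨contDiffAt_const, Eventually.of_forall fun v => ?_⟩, by simp⟩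
    rw [h0]
    exact Realizable.nil v
  | succ j ih =>
    obtain ⟨w, hw, hw0⟩ := ih (by omega)
    let jf : Fin m := ⟨j, hj⟩
    have hMs : ((List.ofFn M).take (j + 1)).reverse =
        M jf :: ((List.ofFn M).take j).reverse := by
      rw [List.take_succ_eq_append_getElem (by simpa using hj)]
      simp [jf]
    rw [hMs]
    by_cases hex : ∃ i, HitsAt t j i
    · classical
      obtain ⟨i₁, hi₁, hmax⟩ := (Finset.univ.filter (HitsAt t j)).exists_max_image id
        (by simpa [Finset.Nonempty] using hex)
      simp only [Finset.mem_filter, Finset.mem_univ, true_and, id] at hi₁ hmax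
      obtain ⟨w₁, h1, h2, h3⟩ := RealizableFamily.create_before_hit (j := jf) (i := i₁) hw
        (Fin.lt_def.2 hi₁.1) hpos hlam (hM jf)
      have h3' : ∀ a b : Fin m, j + 1 ≤ a → a < b → w₁ 0 a < w₁ 0 b :=
        fun a b ha hab => h3 a b (Fin.lt_def.2 ha) hab
      obtain ⟨w₂, h4, h5, h6⟩ := h1.hit (Ms' := M jf :: ((List.ofFn M).take j).reverse) hpos hlam
        (i := i₁) hi₁.1 (by rw [h2]; linarith [hM jf]) h3'
        (Eventually.of_forall fun v => Or.inr (by rw [h2, neg_neg]))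
      have h7 : hitCountFrom t j (i₁ + 1) = hitCount t j := by
        funext l
        have : ¬ (HitsAt t j l ∧ (i₁ : ℕ) + 1 ≤ l) := fun h => by
          have := Fin.le_def.1 (hmax l h.1)
          omega
        rw [hitCountFrom, if_neg this, add_zero]
      rw [← h7, hitCountFrom_add_single hi₁] at h4
      obtain ⟨w₃, h8, h9, i₀, h10, h11, h12⟩ := exists_realizableFamily_of_hits hpos hlam
        (t := t) (j := j) (i₁ := i₁) (i₁ - (j + 1)) (j + 1)
        (by have : j < (i₁ : ℕ) := hi₁.1; omega) le_rfl
        ⟨w₂, h4, h6, i₁, hi₁, le_rfl, h5⟩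
      rw [hitCountFrom_succ ht] at h8
      refine ⟨w₃, h8, fun hno i hi => ?_⟩
      -- If phase `j + 1` has no hits, the last index hit in phase `j` can only be `j + 1`; its
      -- value is `0`, and monotonicity gives the nonnegativity that `create_stiff` needs.
      have h13 : (i₀ : ℕ) = j + 1 := by
        have := hno i₀
        unfold HitsAt at this h10
        omega
      rw [← h12]
      rcases (show i₀ ≤ i from Fin.le_def.2 (by omega)).eq_or_lt with h | h
      · rw [h]
      · exact (h9 i₀ i h11 h).le
    · push Not at hex
      obtain ⟨w', h1, h2⟩ := RealizableFamily.create_stiff (j := jf) hw hpos hlam (hM jf)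
        (fun i hi => hw0 hex i hi)
      have h3 : hitCount t (j + 1) = hitCount t j :=
        funext fun i => hitCount_succ_of_not_hitsAt (hex i)
      rw [h3]
      exact ⟨w', h1, fun _ i hi => h2 i (Fin.lt_def.2 hi)⟩

/-! ### Conclusion -/

theorem exists_injective_of_sublist_map {α β : Type*} {m : ℕ} {M : Fin m → β} {L : List α}
    {f : α → β} (h : (List.ofFn M).reverse.Sublist (L.map f)) :
    ∃ idx : Fin m → Fin L.length, Function.Injective idx ∧ ∀ l, f (L.get (idx l)) = M l := by
  obtain ⟨e, he⟩ := List.sublist_iff_exists_fin_orderEmbedding_get_eq.1 h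
  have hlen : (List.ofFn M).reverse.length = m := by simp
  refine ⟨fun l => Fin.cast (by simp) (e (Fin.cast hlen.symm l.rev)), fun a b hab => ?_,
    fun l => ?_⟩
  · have h1 := e.injective (Fin.cast_injective _ hab)
    exact Fin.rev_injective (Fin.cast_injective _ h1)
  · have h1 := he (Fin.cast hlen.symm l.rev)
    simp only [List.get_eq_getElem, List.getElem_map, List.getElem_reverse, List.getElem_ofFn] at h1
    simp only [List.get_eq_getElem, Fin.val_cast]
    rw [← h1]
    congr 1
    ext
    simp
    omega

theorem proposition2 (m n : ℕ) (M : Fin m → ℝ) (hM : ∀ l, 0 < M l)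
    (lam : Fin m → ℝ) (hpos : ∀ i, 0 < lam i) (hlam : StrictMono lam)
    (t : Fin m → ℕ) (ht1 : ∀ i, 1 ≤ t i) (hsum : ∑ i, t i = n)
    (ht : ∀ i, t i ≤ (i : ℕ) + 1) :
    ∃ mass k b : Fin n → ℝ,
      (∀ j, 0 < mass j) ∧ (∀ j, 0 < k j) ∧ (∀ j, 0 ≤ b j) ∧
      (∃ idx : Fin m → Fin n, Function.Injective idx ∧ ∀ l, mass (idx l) = M l) ∧
      (∏ i, (X - C (lam i)) ^ t i) ∣ pencilDet mass k b := by
  obtain ⟨w, ⟨-, hw⟩, -⟩ := exists_realizableFamily hpos hlam ht hM m le_rfl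
  obtain ⟨L, p, ν, hL, hlen, hsub, hP, -, -, hv, -⟩ := hw.self_of_nhds
  -- The truncated subtraction in `hitCount` is exact because `t i ≤ i + 1`.
  have hcount : ∀ i, t i = hitCount t m i + 1 := fun i => by
    have h1 := ht i
    have h2 := ht1 i
    have h3 := i.isLt
    unfold hitCount
    omega
  have hn : n = L.length := by
    rw [hlen, ← hsum, Finset.sum_congr rfl fun i _ => hcount i, Finset.sum_add_distrib]
    simp [add_comm]
  subst hn
  refine ⟨fun i => (L.get i).1, fun i => (L.get i).2.1, fun i => (L.get i).2.2,
    fun i => (hL _ (L.get_mem i)).1, fun i => (hL _ (L.get_mem i)).2.1,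
    fun i => (hL _ (L.get_mem i)).2.2, ?_, ?_⟩
  · refine exists_injective_of_sublist_map ?_
    rwa [List.take_of_length_le (by simp)] at hsub
  · rw [pencilDet_eq_chainPoly, hP, Finset.prod_congr rfl fun i _ => by rw [hcount i, pow_succ],
      Finset.prod_mul_distrib]
    refine mul_dvd_mul_left _ ?_
    -- The family is taken at `v = 0`, so `p` vanishes at every `λᵢ` and supplies the remaining
    -- simple factors.
    refine Finset.prod_dvd_of_coprime (fun a _ b _ hab => ?_) fun i _ => ?_
    · exact pairwise_coprime_X_sub_C hlam.injective hab
    · rw [dvd_iff_isRoot, IsRoot, (hv i i.isLt).2]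
      simp
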